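/- All graphs are finite and have no loops, but multiple edges are allowed. For a graph $G$, let $\omega(G)$ be its number of connected components and $\mathrm{iso}(G)$ its number of isolated vertices. For a real number $t>0$, $G$ is called $t$-tough if $\omega(G\setminus S)\le \max\{1,\frac1t|S|\}$ for all $S\subseteq V(G)$, and $t$-iso-tough if $\mathrm{iso}(G\setminus S)\le \frac1t|S|$ for all $S\subseteq V(G)$. A near $r$-factor of $G$ is a spanning subgraph in which every vertex has degree $r$, except for at most one vertex, which has degree $r+1$. Let $G$ be a graph, let $r$ be a positive integer and let $n\ge 1$ be a real number. If $G$ is $(r+\frac1n)$-iso-tough and $$\omega(G\setminus S)<\frac1n|S|+2\qquad\text{for all } S\subseteq V(G),$$ then $G$ has a near $r$-factor. In particular, every $1$-tough, $(r+1)$-iso-tough graph has a near $r$-factor. -/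

import Mathlib

namespace Graph

variable {α β : Type*}

/-- The number `iso(G)` of isolated vertices of `G`. -/
noncomputable def numIsolated (G : Graph α β) : ℕ :=
  {v ∈ G.vertexSet | ∀ e, ¬ G.Inc e v}.ncard

/-- The number `ω(G)` of connected components of `G`. Multiple edges do not matter here, so the
components are those of the underlying simple graph on the vertex set. -/
noncomputable def numComponents (G : Graph α β) : ℕ :=
  Nat.card G.toSimpleGraph.ConnectedComponent

/-- The degree of `v` in `G`: edges are counted with multiplicity (and loops, if any, twice). -/
noncomputable def vertexDegree (G : Graph α β) (v : α) : ℕ :=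
  (G.incidenceSet v).ncard + (G.loopSet v).ncard

/-- `G` is `t`-tough: `ω(G ∖ S) ≤ max {1, |S| / t}` for all `S ⊆ V(G)`. -/
def IsTough (G : Graph α β) (t : ℝ) : Prop :=
  ∀ S ⊆ G.vertexSet, ((G.deleteVerts S).numComponents : ℝ) ≤ max 1 (1 / t * (S.ncard : ℝ))

/-- `G` is `t`-iso-tough: `iso(G ∖ S) ≤ |S| / t` for all `S ⊆ V(G)`. -/
def IsIsoTough (G : Graph α β) (t : ℝ) : Prop :=
  ∀ S ⊆ G.vertexSet, ((G.deleteVerts S).numIsolated : ℝ) ≤ 1 / t * (S.ncard : ℝ)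

/-- `F` is a near `f`-factor of `G`: a spanning subgraph in which every vertex `v` has degree
`f v`, except for at most one vertex `u`, whose degree is `f u + 1`. -/
def IsNearFactor (F G : Graph α β) (f : α → ℕ) : Prop :=
  F.IsSpanningSubgraph G ∧
  (∀ v ∈ G.vertexSet, F.vertexDegree v = f v ∨ F.vertexDegree v = f v + 1) ∧
  {u ∈ G.vertexSet | F.vertexDegree u = f u + 1}.Subsingleton

end Graph

universe u

/-! Parallel edges are irrelevant, so the work is in the underlying simple graph `H`. Tutte's gadget
turns a near `r`-factor into a perfect matching: an edge is kept when its two darts are matched to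
each other, and the core at `v` absorbs the `deg v - r` surplus darts. One extra absorbing vertex,
used when `r * |V|` is odd, may free a core vertex and so cause a single excess degree. If there is
no perfect matching, Tutte's theorem gives a barrier; choose one with fewest deleted vertices. Every
deleted vertex then sees at least three classes (`IsMinBarrier.exists_adj_ne`), which forces a rigid
shape: sets `A` (all darts deleted) and `B` (whole core deleted), with every other dart and core
vertex kept. Counting odd classes against deleted vertices violates, for this `A` and `B`, the
deficiency inequality of the `r`-factor theorem (`not_isMinBarrier_gadget`). The toughness
hypotheses prove that inequality (`mul_card_add_card_image_lt`). If `B` has small inner degrees, it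
is coloured greedily with `r - 1` colours and iso-toughness is applied to each colour class;
otherwise a vertex of large inner degree is moved out of `B`. -/

namespace SimpleGraph

open Finset

/-! ### Barriers as vertex labellings -/

section Labelling

variable {V : Type u} {L : Type*} [Fintype V]

open scoped Classical in
/-- The deleted vertices of a partial labelling. -/
noncomputable def unlabelled (c : V → Option L) : Finset V := {x | c x = none}

@[simp]
lemma mem_unlabelled {c : V → Option L} {x : V} : x ∈ unlabelled c ↔ c x = none := by
  simp [unlabelled]

variable [Fintype L]

open scoped Classical in
/-- The labels in `L` that occur an odd number of times; the label `none` marks deleted vertices. -/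
noncomputable def oddLabels (c : V → Option L) : Finset L :=
  {l | Odd #{x | c x = some l}}

/-- A barrier in labelled form: adjacent labelled vertices have the same label, and the labels with
an odd class outnumber the unlabelled vertices by at least two. -/
structure IsBarrier (Γ : SimpleGraph V) (c : V → Option L) : Prop where
  eq_of_adj : ∀ ⦃x y⦄, Γ.Adj x y → c x ≠ none → c y ≠ none → c x = c y
  card_le : #(unlabelled c) + 2 ≤ #(oddLabels c)

/-- A barrier with the least number of unlabelled vertices among those with labels in `L`. -/
structure IsMinBarrier (Γ : SimpleGraph V) (c : V → Option L) : Prop extends IsBarrier Γ c where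
  card_unlabelled_le : ∀ c' : V → Option L, IsBarrier Γ c' → #(unlabelled c) ≤ #(unlabelled c')

open scoped Classical in
@[simp]
lemma mem_oddLabels {c : V → Option L} {l : L} :
    l ∈ oddLabels c ↔ Odd #{x | c x = some l} := by
  simp [oddLabels]

lemma odd_card_oddLabels_iff (c : V → Option L) (hV : Even (Fintype.card V)) :
    Odd #(oddLabels c) ↔ Odd #(unlabelled c) := by
  classical
  have h1 : Fintype.card V = #(unlabelled c) + ∑ l : L, #{x | c x = some l} := by
    have := Finset.card_eq_sum_card_fiberwise (s := (univ : Finset V)) (t := univ) (f := c)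
      (fun _ _ => by simp)
    rw [Fintype.sum_option, card_univ] at this
    rw [this]
    congr! 2
  have h2 := Finset.odd_sum_iff_odd_card_odd (s := (univ : Finset L))
    (fun l => #{x | c x = some l})
  have h3 : ({l | Odd #{x | c x = some l}} : Finset L) = oddLabels c := by
    ext l
    simp
  rw [h3] at h2
  rw [← h2]
  rw [h1, Nat.even_add] at hV
  rw [← Nat.not_even_iff_odd, ← Nat.not_even_iff_odd, hV]

open scoped Classical in
-- If `w` saw only the classes `i` and `j`, then `w` could be restored and merged with both into one
-- class. This loses one deleted vertex and at most one odd class, so the result is a smaller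
-- barrier.
lemma IsMinBarrier.exists_adj_ne {Γ : SimpleGraph V} {c : V → Option L} (hc : IsMinBarrier Γ c)
    {w : V} (hw : c w = none) (i j : L) :
    ∃ x, Γ.Adj w x ∧ c x ≠ none ∧ c x ≠ some i ∧ c x ≠ some j := by
  by_contra! hcon
  let d : V → Option L := fun x => if x = w then some i else if c x = some j then some i else c x
  have hdw : d w = some i := by simp [d]
  have hd : ∀ x, x ≠ w → d x = if c x = some j then some i else c x := fun x hx => by simp [d, hx]
  have hun : unlabelled d = (unlabelled c).erase w := by
    ext x
    by_cases hx : x = w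
    · simp [hx, hdw]
    · by_cases hj : c x = some j <;> simp [hx, hd, hj]
  have hwm : w ∈ unlabelled c := by simpa using hw
  have hcl : ∀ l, l ≠ i → l ≠ j →
      ({x | d x = some l} : Finset V) = ({x | c x = some l} : Finset V) := by
    intro l hi hj
    ext x
    by_cases hx : x = w
    · simp [hx, hdw, hw, hi.symm]
    · by_cases hj' : c x = some j <;> simp [hx, hd, hj', hi.symm, hj.symm]
  have hnbr : ∀ x, Γ.Adj w x → d x = none ∨ d x = some i := by
    intro x hx
    rw [hd x hx.ne']
    have := hcon x hx
    split_ifs with h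
    · exact .inr rfl
    · tauto
  have hbar : IsBarrier Γ d := by
    refine ⟨fun x y hxy hx hy => ?_, ?_⟩
    · by_cases hxw : x = w
      · subst hxw
        rw [hdw]
        exact ((hnbr y hxy).resolve_left hy).symm
      by_cases hyw : y = w
      · subst hyw
        rw [hdw]
        exact (hnbr x hxy.symm).resolve_left hx
      have := hc.eq_of_adj hxy
      rw [hd x hxw, hd y hyw] at *
      by_cases h1 : c x = some j <;> by_cases h2 : c y = some j <;> simp_all
    -- At most one odd label is lost. The critical case is two distinct odd classes: merged together
    -- with `w` they have odd total size, so `i` survives and only `j` disappears.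
    · have hkey : ∃ l, (oddLabels c).erase l ⊆ oddLabels d := by
        by_cases hoi : i ∈ oddLabels c
        · by_cases hij : i = j
          · refine ⟨i, fun l hl => ?_⟩
            rw [mem_erase] at hl
            rw [mem_oddLabels, hcl l hl.1 (hij ▸ hl.1), ← mem_oddLabels]
            exact hl.2
          by_cases hoj : j ∈ oddLabels c
          · refine ⟨j, fun l hl => ?_⟩
            rw [mem_erase] at hl
            by_cases hli : l = i
            · subst hli
              rw [mem_oddLabels] at hoi hoj ⊢
              have : ({x | d x = some l} : Finset V) =
                  insert w (({x | c x = some l} : Finset V) ∪ ({x | c x = some j} : Finset V)) := by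
                ext x
                by_cases hx : x = w
                · simp [hx, hdw]
                · by_cases hj' : c x = some j <;> simp [hx, hd, hj']
              rw [this, card_insert_of_notMem (by simp [hw]), card_union_of_disjoint]
              · exact (hoi.add_odd hoj).add_one
              · rw [Finset.disjoint_left]
                intro x hx hx'
                simp only [mem_filter, mem_univ, true_and] at hx hx'
                rw [hx] at hx'
                exact hij (Option.some_injective _ hx')
            · rw [mem_oddLabels, hcl l hli hl.1, ← mem_oddLabels]
              exact hl.2
          · refine ⟨i, fun l hl => ?_⟩
            rw [mem_erase] at hl
            rw [mem_oddLabels, hcl l hl.1 (fun h => hoj (h ▸ hl.2)), ← mem_oddLabels]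
            exact hl.2
        · refine ⟨j, fun l hl => ?_⟩
          rw [mem_erase] at hl
          rw [mem_oddLabels, hcl l (fun h => hoi (h ▸ hl.2)) hl.1, ← mem_oddLabels]
          exact hl.2
      obtain ⟨l, hl⟩ := hkey
      have h1 := card_le_card hl
      have h2 := pred_card_le_card_erase (s := oddLabels c) (a := l)
      have h3 := hc.card_le
      have h4 := card_erase_add_one hwm
      rw [hun]
      omega
  have h1 := hc.card_unlabelled_le d hbar
  have h2 := card_erase_add_one hwm
  rw [hun] at h1
  omega

lemma IsBarrier.exists_isMinBarrier {Γ : SimpleGraph V} {c : V → Option L} (hc : IsBarrier Γ c) :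
    ∃ c' : V → Option L, IsMinBarrier Γ c' := by
  classical
  obtain ⟨d, hd, hmin⟩ := Set.exists_min_image {d : V → Option L | IsBarrier Γ d}
    (fun d => #(unlabelled d)) (Set.toFinite _) ⟨c, hc⟩
  exact ⟨d, hd, hmin⟩

end Labelling

/-- Tutte's theorem in labelled form. -/
theorem exists_isMinBarrier {V : Type u} [Fintype V] (Γ : SimpleGraph V)
    (hV : Even (Fintype.card V)) (h : ∀ M : Γ.Subgraph, ¬ M.IsPerfectMatching) :
    ∃ (L : Type u) (_ : Fintype L) (c : V → Option L), IsMinBarrier Γ c := by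
  classical
  obtain ⟨U, hU⟩ : ∃ U, Γ.IsTutteViolator U := by
    by_contra! hcon
    obtain ⟨M, hM⟩ := tutte.2 hcon
    exact h M hM
  let H := ((⊤ : Γ.Subgraph).deleteVerts U).coe
  have hmem : ∀ x, x ∈ ((⊤ : Γ.Subgraph).deleteVerts U).verts ↔ x ∉ U := fun x => by simp
  let : Fintype H.ConnectedComponent := Fintype.ofFinite _
  let c : V → Option H.ConnectedComponent := fun x =>
    if hx : x ∈ ((⊤ : Γ.Subgraph).deleteVerts U).verts then some (H.connectedComponentMk ⟨x, hx⟩)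
    else none
  refine ⟨H.ConnectedComponent, inferInstance, IsBarrier.exists_isMinBarrier (c := c) ⟨?_, ?_⟩⟩
  · intro x y hxy hx hy
    have hx' : x ∈ ((⊤ : Γ.Subgraph).deleteVerts U).verts := by
      by_contra hn
      exact hx (dif_neg hn)
    have hy' : y ∈ ((⊤ : Γ.Subgraph).deleteVerts U).verts := by
      by_contra hn
      exact hy (dif_neg hn)
    simp only [c, dif_pos hx', dif_pos hy', Option.some.injEq, ConnectedComponent.eq]
    apply Adj.reachable
    rw [hmem] at hx' hy'
    simp [H, hxy, hx', hy']
  · have hun : #(unlabelled c) = U.ncard := by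
      rw [← Set.ncard_coe_finset]
      congr 1
      ext x
      by_cases hx : x ∈ U <;> simp [c, hx]
    have hodd : #(oddLabels c) = H.oddComponents.ncard := by
      rw [← Set.ncard_coe_finset]
      congr 1
      ext l
      simp only [mem_coe, mem_oddLabels, Set.mem_ofPred_eq]
      have : #{x | c x = some l} = l.supp.ncard := by
        rw [← Set.ncard_image_of_injective _ Subtype.val_injective, ← Set.ncard_coe_finset]
        congr 1
        ext x
        simp only [coe_filter, mem_univ, true_and, Set.mem_ofPred_eq, Set.mem_image,
          ConnectedComponent.mem_supp_iff, Subtype.exists, exists_and_right, exists_eq_right]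
        by_cases hx : x ∈ ((⊤ : Γ.Subgraph).deleteVerts U).verts
        · simp only [c, dif_pos hx, Option.some.injEq]
          exact ⟨fun h => ⟨hx, h⟩, fun ⟨_, h⟩ => h⟩
        · simp only [c, dif_neg hx]
          exact ⟨fun h => by simp at h, fun ⟨h, _⟩ => absurd h hx⟩
      rw [this]
    -- Tutte's condition fails by at least one; since `|V|` is even, parity raises this to two.
    have h1 := odd_card_oddLabels_iff c hV
    have h2 : U.ncard < H.oddComponents.ncard := hU
    rw [← hun, ← hodd] at h2
    rcases Nat.lt_or_ge (#(unlabelled c) + 1) #(oddLabels c) with h3 | h3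
    · exact h3
    · have h4 : #(oddLabels c) = #(unlabelled c) + 1 := by omega
      rw [h4, Nat.odd_add_one] at h1
      tauto

/-! ### The deficiency inequality from toughness -/

section Deficiency

variable {V : Type u} [Fintype V] [DecidableEq V] (H : SimpleGraph V) [DecidableRel H.Adj]

/-- Greedy colouring of the subgraph induced on `B`. -/
lemma exists_coloring_of_card_inter_lt (B : Finset V) {k : ℕ}
    (hB : ∀ v ∈ B, #(H.neighborFinset v ∩ B) < k) :
    ∃ c : V → ℕ, (∀ v ∈ B, c v < k) ∧ ∀ u ∈ B, ∀ v ∈ B, H.Adj u v → c u ≠ c v := by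
  induction B using Finset.induction_on with
  | empty => exact ⟨fun _ => 0, by simp, by simp⟩
  | insert a B ha ih =>
    obtain ⟨c, hc, hcol⟩ := ih fun v hv =>
      (card_le_card (inter_subset_inter_left (subset_insert a B))).trans_lt
        (hB v (mem_insert_of_mem hv))
    obtain ⟨i, hi, hi'⟩ : ∃ i ∈ range k, i ∉ (H.neighborFinset a ∩ B).image c := by
      apply exists_mem_notMem_of_card_lt_card
      rw [card_range]
      refine card_image_le.trans_lt ((card_le_card ?_).trans_lt (hB a (mem_insert_self a B)))
      exact inter_subset_inter_left (subset_insert a B)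
    have hne : ∀ v ∈ B, v ≠ a := fun v hv h => ha (h ▸ hv)
    have hfree : ∀ v ∈ B, H.Adj a v → c v ≠ i := fun v hv h h' =>
      hi' (mem_image.2 ⟨v, by simp [hv, h], h'⟩)
    refine ⟨Function.update c a i, fun v hv => ?_, fun u hu v hv huv => ?_⟩
    · by_cases hva : v = a
      · simpa [hva] using hi
      · rw [Function.update_of_ne hva]
        exact hc v ((mem_insert.1 hv).resolve_left hva)
    · by_cases hua : u = a
      · subst hua
        have hvB := (mem_insert.1 hv).resolve_left huv.ne'
        rw [Function.update_self, Function.update_of_ne huv.ne']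
        exact (hfree v hvB huv).symm
      have huB := (mem_insert.1 hu).resolve_left hua
      by_cases hva : v = a
      · subst hva
        rw [Function.update_self, Function.update_of_ne hua]
        exact hfree u huB huv.symm
      rw [Function.update_of_ne hua, Function.update_of_ne hva]
      exact hcol u huB v ((mem_insert.1 hv).resolve_left hva) huv

/-- Every set of vertices all of whose neighbours lie in `S` has at most `|S| / t` elements. -/
def IsolatingBound (t : ℝ) : Prop :=
  ∀ S I : Finset V, Disjoint S I → (∀ v ∈ I, ∀ u, H.Adj v u → u ∈ S) → t * #I ≤ #S

/-- Every labelling that is constant on the components of `H - S` takes fewer than `s |S| + 2`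
values outside `S`. -/
def ComponentBound (s : ℝ) : Prop :=
  ∀ (S : Finset V) (L : Type u) [DecidableEq L] (c : V → L),
    (∀ u v, u ∉ S → v ∉ S → H.Adj u v → c u = c v) → (#(Sᶜ.image c) : ℝ) < s * #S + 2

variable {H} in
-- Colour `B` greedily with `k` colours. Each class is independent, so deleting `A` and its
-- neighbours outside `A` isolates it; the bounds for the classes are then added up.
lemma IsolatingBound.mul_card_le {t : ℝ} (h : IsolatingBound H t) {A B : Finset V}
    (hAB : Disjoint A B) {k : ℕ} (hB : ∀ v ∈ B, #(H.neighborFinset v ∩ B) < k) :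
    t * #B ≤ k * #A + ∑ v ∈ B, (#(H.neighborFinset v \ A) : ℝ) := by
  obtain ⟨c, hc, hcol⟩ := H.exists_coloring_of_card_inter_lt B hB
  have hclass : ∀ i ∈ range k, t * #{v ∈ B | c v = i} ≤
      #A + ∑ v ∈ B with c v = i, (#(H.neighborFinset v \ A) : ℝ) := by
    intro i _
    refine (h (A ∪ ({v ∈ B | c v = i} : Finset V).biUnion fun v => H.neighborFinset v \ A)
      {v ∈ B | c v = i} ?_ ?_).trans ?_
    · rw [Finset.disjoint_left]
      intro u hu hui
      rw [mem_filter] at hui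
      simp only [mem_union, mem_biUnion, mem_filter, mem_sdiff, mem_neighborFinset] at hu
      obtain hu | ⟨v, ⟨hv, hvi⟩, hvu, -⟩ := hu
      · exact Finset.disjoint_left.1 hAB hu hui.1
      · exact hcol v hv u hui.1 hvu (hvi.trans hui.2.symm)
    · intro v hv u hvu
      by_cases huA : u ∈ A
      · exact mem_union_left _ huA
      · exact mem_union_right _ (mem_biUnion.2 ⟨v, hv, by simp [hvu, huA]⟩)
    · have h1 := card_union_le A
        (({v ∈ B | c v = i} : Finset V).biUnion fun v => H.neighborFinset v \ A)
      have h2 := card_biUnion_le (s := ({v ∈ B | c v = i} : Finset V))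
        (t := fun v => H.neighborFinset v \ A)
      exact_mod_cast h1.trans (Nat.add_le_add_left h2 _)
  have hmaps : ∀ v ∈ B, c v ∈ range k := fun v hv => mem_range.2 (hc v hv)
  have hsum := sum_le_sum hclass
  rw [sum_add_distrib, sum_fiberwise_of_maps_to hmaps, ← mul_sum, sum_const, card_range,
    nsmul_eq_mul] at hsum
  have hcard : (#B : ℝ) = ∑ i ∈ range k, (#{v ∈ B | c v = i} : ℝ) := by
    exact_mod_cast card_eq_sum_card_fiberwise hmaps
  rwa [hcard]

/-- The deficiency inequality of the `r`-factor theorem, with all components counted. -/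
theorem mul_card_add_card_image_lt {r : ℕ} {s : ℝ} (hs1 : s ≤ 1) (hr : 1 ≤ r)
    (hiso : IsolatingBound H (r + s)) (hcomp : ComponentBound H s) (A : Finset V) (m : ℕ) :
    ∀ (B : Finset V) (L : Type u) [DecidableEq L] (c : V → L), #B = m → Disjoint A B →
      (∀ u v, u ∉ A ∪ B → v ∉ A ∪ B → H.Adj u v → c u = c v) →
      r * #B + #((A ∪ B)ᶜ.image c) < 2 + r * #A + ∑ v ∈ B, #(H.neighborFinset v \ A) := by
  induction m with
  | zero =>
    intro B L _ c hB hAB hc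
    obtain rfl : B = ∅ := card_eq_zero.1 hB
    rw [union_empty] at *
    have h1 := hcomp A L c hc
    have h2 : s * #A ≤ r * (#A : ℝ) := by
      have : (1 : ℝ) ≤ r := by exact_mod_cast hr
      gcongr
      linarith
    have h3 : (#(Aᶜ.image c) : ℝ) < 2 + r * #A := by linarith
    simpa using (by exact_mod_cast h3 : #(Aᶜ.image c) < 2 + r * #A)
  | succ m ih =>
    intro B L _ c hB hAB hc
    -- With `r - 1` colours, the leftover `|A|` on the right pays for the term `s * |A| ≤ |A|` of
    -- the component bound for `A ∪ B`, and `s * |B|` cancels. For `r = 1` this case is void, as `B`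
    -- is nonempty.
    by_cases hdeg : ∀ v ∈ B, #(H.neighborFinset v ∩ B) < r - 1
    · have h1 := hiso.mul_card_le hAB hdeg
      have h2 := hcomp (A ∪ B) L c hc
      rw [card_union_of_disjoint hAB] at h2
      push_cast [hr] at h1 h2
      have h3 : s * #A ≤ 1 * (#A : ℝ) := by gcongr
      have h4 : (r * #B + #((A ∪ B)ᶜ.image c) : ℝ) <
          2 + r * #A + ∑ v ∈ B, (#(H.neighborFinset v \ A) : ℝ) := by linarith
      exact_mod_cast h4
    · push Not at hdeg
      obtain ⟨v, hvB, hv⟩ := hdeg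
      have hvA : v ∉ A := fun h => Finset.disjoint_left.1 hAB h hvB
      -- Moving `v` out of `B` fuses `v` and the classes in `M` that it touches into the single
      -- class `none`. At most `#M - 1` classes are lost, while `v` has at least `(r - 1) + #M`
      -- neighbours outside `A`, which is exactly enough.
      let M := (H.neighborFinset v \ (A ∪ B)).image c
      let d : V → Option L := fun x => if x = v ∨ c x ∈ M then none else some (c x)
      have hd : ∀ x y, x ∉ A ∪ B.erase v → y ∉ A ∪ B.erase v → H.Adj x y → d x = d y := by
        have key : ∀ x, x ∉ A ∪ B.erase v → H.Adj v x → d x = none := by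
          intro x hx hvx
          refine if_pos (.inr (mem_image_of_mem c ?_))
          simp only [mem_sdiff, mem_neighborFinset, hvx, true_and]
          simpa [hvx.ne'] using hx
        intro x y hx hy hxy
        have hdv : d v = none := if_pos (.inl rfl)
        by_cases hxv : x = v
        · subst hxv
          rw [hdv, key y hy hxy]
        by_cases hyv : y = v
        · subst hyv
          rw [hdv, key x hx hxy.symm]
        have := hc x y (by simpa [hxv] using hx) (by simpa [hyv] using hy) hxy
        simp [d, hxv, hyv, this]
      have h1 := ih (B.erase v) (Option L) d (by rw [card_erase_of_mem hvB, hB]; rfl)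
        (hAB.mono_right (erase_subset v B)) hd
      have himg : ((A ∪ B)ᶜ.image c \ M).card + 1 ≤ #((A ∪ B.erase v)ᶜ.image d) := by
        rw [← card_insertNone]
        apply card_le_card
        intro o ho
        rw [mem_image]
        cases o with
        | none => exact ⟨v, by simp [hvA], if_pos (.inl rfl)⟩
        | some l =>
          rw [some_mem_insertNone, mem_sdiff, mem_image] at ho
          obtain ⟨⟨x, hx, rfl⟩, hl⟩ := ho
          have hxB : x ∉ A ∧ x ∉ B := by simpa using hx
          have hxv : x ≠ v := fun h => hxB.2 (h ▸ hvB)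
          exact ⟨x, by simp [hxB.1, hxB.2], if_neg (by simp [hxv, hl])⟩
      have hM : #((A ∪ B)ᶜ.image c) ≤ #((A ∪ B)ᶜ.image c \ M) + #M :=
        card_le_card_sdiff_add_card
      have hM' : #M ≤ #(H.neighborFinset v \ (A ∪ B)) := card_image_le
      have hsplit : #(H.neighborFinset v \ A) =
          #(H.neighborFinset v ∩ B) + #(H.neighborFinset v \ (A ∪ B)) := by
        rw [← card_union_of_disjoint]
        · congr 1
          ext x
          have : x ∈ A → x ∉ B := fun h => Finset.disjoint_left.1 hAB h
          simp only [mem_sdiff, mem_union, mem_inter]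
          tauto
        · rw [Finset.disjoint_left]
          intro x hx hx'
          simp only [mem_sdiff, mem_union, mem_inter] at hx hx'
          tauto
      have hsumB := add_sum_erase B (fun v => #(H.neighborFinset v \ A)) hvB
      have hcardB := card_erase_add_one hvB
      rw [← hsumB, ← hcardB]
      rw [mul_add]
      omega

end Deficiency

/-! ### Tutte's gadget and its perfect matchings -/

section Gadget

variable {V : Type u} [Fintype V] [DecidableEq V] (H : SimpleGraph V) [DecidableRel H.Adj]
  (r s : ℕ)

/-- Vertices of Tutte's gadget: the darts of `H`, a core of `deg v - r` vertices at each `v`, and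
`s` absorbing vertices. -/
abbrev GadgetVertex : Type u := H.Dart ⊕ ((v : V) × Fin (H.degree v - r)) ⊕ Fin s

/-- Tutte's gadget: each dart is joined to its reverse and to the core at its first vertex, and all
core vertices are joined to all absorbing vertices. -/
def gadget : SimpleGraph (H.GadgetVertex r s) where
  Adj
    | .inl a, .inl b => b = a.symm
    | .inl a, .inr (.inl k) => a.fst = k.1
    | .inr (.inl k), .inl a => a.fst = k.1
    | .inr (.inl _), .inr (.inr _) => True
    | .inr (.inr _), .inr (.inl _) => True
    | _, _ => False
  symm := ⟨by
    rintro (a | k | z) (b | l | y) h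
    · change b = a.symm at h
      change a = b.symm
      rw [h, Dart.symm_symm]
    all_goals exact h⟩
  loopless := ⟨by
    rintro (a | k | z) h
    · exact a.symm_ne.symm h
    · exact h
    · exact h⟩

variable {H r s}

omit [DecidableEq V] in
lemma even_card_gadgetVertex (hdeg : ∀ v, r ≤ H.degree v) (hs : Even (r * Fintype.card V + s)) :
    Even (Fintype.card (H.GadgetVertex r s)) := by
  have h1 : ∑ v, (H.degree v - r) + r * Fintype.card V = ∑ v, H.degree v := by
    rw [← card_univ, mul_comm, ← smul_eq_mul, ← sum_const, ← sum_add_distrib]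
    exact sum_congr rfl fun v _ => Nat.sub_add_cancel (hdeg v)
  have h2 := H.sum_degrees_eq_twice_card_edges
  simp only [Fintype.card_sum, Fintype.card_sigma, Fintype.card_fin, dart_card_eq_twice_card_edges]
  rw [Nat.even_iff] at *
  omega

/-- A perfect matching of the gadget yields a factor with at most `s` units of excess degree. -/
theorem exists_factor_of_isPerfectMatching (hdeg : ∀ v, r ≤ H.degree v) (hs : s ≤ 1)
    {M : (H.gadget r s).Subgraph} (hM : M.IsPerfectMatching) :
    ∃ F : SimpleGraph V, F ≤ H ∧
      (∀ v, (F.neighborSet v).ncard = r ∨ (F.neighborSet v).ncard = r + 1) ∧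
      ∀ u v, (F.neighborSet u).ncard = r + 1 → (F.neighborSet v).ncard = r + 1 → u = v := by
  classical
  have huniq : ∀ {x y z}, M.Adj x y → M.Adj x z → y = z := fun {x y z} hy hz =>
    (hM.1 (hM.2 x)).unique hy hz
  have hex : ∀ x, ∃ y, M.Adj x y := fun x => (hM.1 (hM.2 x)).exists
  let F : SimpleGraph V :=
    { Adj u v := ∃ h : H.Adj u v, M.Adj (.inl ⟨(u, v), h⟩) (.inl ⟨(v, u), h.symm⟩)
      symm := ⟨fun u v ⟨h, h'⟩ => ⟨h.symm, h'.symm⟩⟩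
      loopless := ⟨fun v ⟨h, _⟩ => h.ne rfl⟩ }
  have hFH : F ≤ H := fun u v h => h.1
  let Y (v : V) : Finset (Fin (H.degree v - r)) :=
    {k | ∃ u, ∃ h : H.Adj v u, M.Adj (.inl ⟨(v, u), h⟩) (.inr (.inl ⟨v, k⟩))}
  -- A dart not matched to its reverse must be matched into the core at its first vertex, so the
  -- rejected edges at `v` correspond bijectively to `Y v`. The degree of `v` in `F` is therefore
  -- `r` plus the number of core vertices at `v` matched to absorbing vertices.
  have hout : ∀ v, #(H.neighborFinset v \ F.neighborFinset v) = #(Y v) := by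
    intro v
    let R : V → Fin (H.degree v - r) → Prop := fun u k =>
      ∃ h : H.Adj v u, M.Adj (.inl ⟨(v, u), h⟩) (.inr (.inl ⟨v, k⟩))
    apply le_antisymm
    · refine card_le_card_of_forall_subsingleton R ?_ ?_
      · intro u hu
        simp only [mem_sdiff, mem_neighborFinset] at hu
        obtain ⟨y, hy⟩ := hex (.inl ⟨(v, u), hu.1⟩)
        have hadj := hy.adj_sub
        obtain b | ⟨w, k⟩ | z := y
        · obtain rfl : b = Dart.symm _ := hadj
          exact absurd ⟨hu.1, hy⟩ hu.2
        · obtain rfl : v = w := hadj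
          exact ⟨k, by simpa [Y] using ⟨u, hu.1, hy⟩, hu.1, hy⟩
        · exact hadj.elim
      · rintro k - u ⟨-, h, hu⟩ u' ⟨-, h', hu'⟩
        have := huniq hu.symm hu'.symm
        simpa using this
    · refine card_le_card_of_forall_subsingleton (fun k u => R u k) ?_ ?_
      · intro k hk
        simp only [Y, mem_filter, mem_univ, true_and] at hk
        obtain ⟨u, h, hu⟩ := hk
        refine ⟨u, ?_, h, hu⟩
        simp only [mem_sdiff, mem_neighborFinset, h, true_and]
        rintro ⟨_, h'⟩
        simpa using huniq hu h'
      · rintro u - k ⟨-, h, hk⟩ k' ⟨-, h', hk'⟩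
        have := huniq hk hk'
        simpa using this
  have hrest : ∀ v, ∀ k ∉ Y v, ∃ z, M.Adj (.inr (.inl ⟨v, k⟩)) (.inr (.inr z)) := by
    intro v k hk
    obtain ⟨y, hy⟩ := hex (.inr (.inl ⟨v, k⟩))
    have hadj := hy.adj_sub
    obtain ⟨⟨w, u⟩, h⟩ | l | z := y
    · obtain rfl : w = v := hadj
      exact absurd (by simpa [Y] using ⟨u, h, hy.symm⟩) hk
    · exact hadj.elim
    · exact ⟨z, hy⟩
  have hz : ∀ z z' : Fin s, z = z' := fun z z' => by
    ext
    omega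
  have hone : ∀ v k w l, k ∉ Y v → l ∉ Y w →
      (⟨v, k⟩ : (v : V) × Fin (H.degree v - r)) = ⟨w, l⟩ := by
    intro v k w l hk hl
    obtain ⟨z, hz1⟩ := hrest v k hk
    obtain ⟨z', hz2⟩ := hrest w l hl
    obtain rfl := hz z z'
    simpa using huniq hz1.symm hz2.symm
  have hcompl : ∀ v, #(Y v)ᶜ ≤ 1 := fun v => card_le_one.2 fun k hk l hl => by
    simpa using hone v k v l (mem_compl.1 hk) (mem_compl.1 hl)
  have hcard : ∀ v, (F.neighborSet v).ncard = r + #(Y v)ᶜ := by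
    intro v
    have h1 : F.neighborFinset v ⊆ H.neighborFinset v := by
      intro u hu
      rw [mem_neighborFinset] at *
      exact hFH hu
    have h2 := card_sdiff_add_card_eq_card h1
    have h3 := card_add_card_compl (Y v)
    rw [Fintype.card_fin] at h3
    rw [hout, H.card_neighborFinset_eq_degree] at h2
    have h4 := hdeg v
    rw [Set.ncard_eq_toFinset_card', ← neighborFinset_def]
    omega
  refine ⟨F, hFH, fun v => ?_, fun u v hu hv => ?_⟩
  · have h1 := hcompl v
    have h2 := hcard v
    omega
  · rw [hcard] at hu hv
    obtain ⟨k, hk⟩ := card_pos.1 (show 0 < #(Y u)ᶜ by omega)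
    obtain ⟨l, hl⟩ := card_pos.1 (show 0 < #(Y v)ᶜ by omega)
    exact congrArg Sigma.fst (hone u k v l (mem_compl.1 hk) (mem_compl.1 hl))

lemma card_darts_between (X Y : Finset V) :
    #{a : H.Dart | a.fst ∈ X ∧ a.snd ∈ Y} = ∑ v ∈ X, #(H.neighborFinset v ∩ Y) := by
  rw [← card_sigma]
  refine card_bij' (fun a _ => ⟨a.fst, a.snd⟩)
    (fun p hp => ⟨(p.1, p.2), by simpa using (mem_inter.1 (mem_sigma.1 hp).2).1⟩) ?_ ?_ ?_ ?_
  · intro a ha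
    simp only [mem_filter, mem_univ, true_and] at ha
    simp [ha, a.adj]
  · intro p hp
    simp only [mem_sigma, mem_inter] at hp
    simp [hp]
  · intro a _
    rfl
  · intro p _
    rfl

end Gadget

/-! ### Shape of a minimal barrier in the gadget -/

section Barrier

variable {V : Type u} [Fintype V] [DecidableEq V] {H : SimpleGraph V} [DecidableRel H.Adj]
  {r s : ℕ} {L : Type u} [Fintype L] {c : H.GadgetVertex r s → Option L}

omit [DecidableEq V] in
-- Core vertices at the same `v` are twins: if one is kept, all kept neighbours of the others carry
-- its label, so a deleted one would see only one class.
lemma IsMinBarrier.core_ne_none (hc : IsMinBarrier (H.gadget r s) c) {v : V}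
    (h : ∃ k, c (.inr (.inl ⟨v, k⟩)) ≠ none) (k : Fin (H.degree v - r)) :
    c (.inr (.inl ⟨v, k⟩)) ≠ none := by
  intro hk
  obtain ⟨k₀, hk₀⟩ := h
  obtain ⟨i, hi⟩ := Option.ne_none_iff_exists'.1 hk₀
  obtain ⟨x, hx, hx0, hxi, -⟩ := hc.exists_adj_ne hk i i
  have hx' : (H.gadget r s).Adj (.inr (.inl ⟨v, k₀⟩)) x := by
    obtain a | l | z := x
    exacts [hx, hx, hx]
  exact hxi (hi ▸ (hc.eq_of_adj hx' hk₀ hx0).symm)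

omit [DecidableEq V] in
/-- An unlabelled dart sees at least two labels in the core at its first vertex. -/
lemma IsMinBarrier.dart_ne_none (hc : IsMinBarrier (H.gadget r s) c) {a : H.Dart} (i : L)
    (h : ∀ k, c (.inr (.inl ⟨a.fst, k⟩)) = none ∨ c (.inr (.inl ⟨a.fst, k⟩)) = some i) :
    c (.inl a) ≠ none := by
  intro ha
  obtain ⟨j, hj⟩ : ∃ j, c (.inl a.symm) = none ∨ c (.inl a.symm) = some j := by
    rcases h : c (.inl a.symm) with _ | j
    · exact ⟨i, .inl rfl⟩
    · exact ⟨j, .inr rfl⟩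
  obtain ⟨x, hx, hx0, hxi, hxj⟩ := hc.exists_adj_ne ha i j
  obtain b | ⟨w, k⟩ | z := x
  · obtain rfl : b = a.symm := hx
    tauto
  · obtain rfl : a.fst = w := hx
    have := h k
    tauto
  · exact hx

theorem not_isMinBarrier_gadget (hdeg : ∀ v, r < H.degree v) (hs : s ≤ 1)
    (hdef : ∀ (A B : Finset V) (L : Type u) [DecidableEq L] (c : V → L), Disjoint A B →
      (∀ u v, u ∉ A ∪ B → v ∉ A ∪ B → H.Adj u v → c u = c v) →
      r * #B + #((A ∪ B)ᶜ.image c) < 2 + r * #A + ∑ v ∈ B, #(H.neighborFinset v \ A)) :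
    ¬ IsMinBarrier (H.gadget r s) c := by
  classical
  intro hc
  obtain ⟨l₀, -⟩ : (oddLabels c).Nonempty := card_pos.1 (by have := hc.card_le; omega)
  let P : H.Dart → Option L := fun a => c (.inl a)
  let K : (v : V) × Fin (H.degree v - r) → Option L := fun k => c (.inr (.inl k))
  let B : Finset V := {v | ∀ k, K ⟨v, k⟩ = none}
  let A : Finset V := {v | v ∉ B ∧ ∀ a : H.Dart, a.fst = v → P a = none}
  -- The core is nonempty because `r < deg v`. Outside `A ∪ B` the core vertices and darts at `v`
  -- all share one label, so any core vertex represents it.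
  let μ : V → Option L := fun v => K ⟨v, ⟨0, Nat.sub_pos_of_lt (hdeg v)⟩⟩
  have hAB : Disjoint A B := Finset.disjoint_left.2 fun v hv => by simp [A] at hv; tauto
  have hB : ∀ v ∈ B, ∀ k, K ⟨v, k⟩ = none := fun v hv => by simpa [B] using hv
  have hA : ∀ a : H.Dart, a.fst ∈ A → P a = none := fun a ha => (mem_filter.1 ha).2.2 a rfl
  have hK : ∀ v ∉ B, ∀ k, K ⟨v, k⟩ ≠ none := by
    intro v hv
    simp only [B, mem_filter, mem_univ, true_and, not_forall] at hv
    exact hc.core_ne_none hv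
  have hPB : ∀ a : H.Dart, a.fst ∈ B → P a ≠ none := fun a ha =>
    hc.dart_ne_none l₀ fun k => .inl (hB _ ha k)
  have hKP : ∀ (a : H.Dart) (v), a.fst = v → v ∉ B → P a ≠ none → ∀ k, K ⟨v, k⟩ = P a := by
    rintro a _ rfl ha hPa k
    exact hc.eq_of_adj (x := .inr (.inl ⟨a.fst, k⟩)) (y := .inl a) rfl (hK _ ha k) hPa
  have hPU : ∀ a : H.Dart, a.fst ∉ B → a.fst ∉ A → P a ≠ none := by
    intro a haB haA
    simp only [A, mem_filter, mem_univ, true_and, not_and, not_forall] at haA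
    obtain ⟨b, hb, hPb⟩ := haA haB
    obtain ⟨i, hi⟩ := Option.ne_none_iff_exists'.1 hPb
    refine hc.dart_ne_none i fun k => .inr ?_
    rw [← hi, ← hKP b _ hb haB hPb k]
  have hμ : ∀ a : H.Dart, a.fst ∉ B → a.fst ∉ A → μ a.fst = P a := fun a haB haA =>
    hKP a _ rfl haB (hPU a haB haA) _
  have hPP : ∀ a : H.Dart, P a ≠ none → P a.symm ≠ none → P a = P a.symm := fun a h h' =>
    hc.eq_of_adj (x := .inl a) (y := .inl a.symm) rfl h h'
  have hPne : ∀ a : H.Dart, a.fst ∉ A → P a ≠ none := fun a ha => by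
    by_cases haB : a.fst ∈ B
    exacts [hPB a haB, hPU a haB ha]
  have hμadj : ∀ u v, u ∉ A ∪ B → v ∉ A ∪ B → H.Adj u v → μ u = μ v := by
    intro u v hu hv huv
    rw [mem_union, not_or] at hu hv
    let a : H.Dart := ⟨(u, v), huv⟩
    exact (hμ a hu.2 hu.1).trans ((hPP a (hPne a hu.1) (hPne a.symm hv.1)).trans
      (hμ a.symm hv.2 hv.1).symm)
  -- A class meeting none of these places consists of darts with both ends in `B`. Dart reversal
  -- acts on it without fixed points, so its size is even.
  have hcover : ∀ l ∈ oddLabels c, (∃ v ∈ A, ∃ k, K ⟨v, k⟩ = some l) ∨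
      (∃ a : H.Dart, (a.fst ∈ B ∧ a.snd ∈ A) ∧ P a = some l) ∨
      (∃ v ∉ A ∪ B, μ v = some l) ∨ ∃ z, c (.inr (.inr z)) = some l := by
    intro l hl
    by_contra! hcon
    obtain ⟨h1, h2, h3, h4⟩ := hcon
    have hall : ∀ x, c x = some l → ∃ a : H.Dart, x = .inl a ∧ a.fst ∈ B ∧ a.snd ∈ B := by
      rintro (a | ⟨v, k⟩ | z) hx
      · refine ⟨a, rfl, ?_⟩
        have hPa : P a = some l := hx
        have haA : a.fst ∉ A := fun h => by simp [hA a h] at hPa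
        have haB : a.fst ∈ B := by
          by_contra h
          exact h3 a.fst (by simp [h, haA]) ((hμ a h haA).trans hPa)
        refine ⟨haB, ?_⟩
        have haA' : a.snd ∉ A := fun h => h2 a ⟨haB, h⟩ hPa
        by_contra h
        refine h3 a.snd (by simp [h, haA']) ((hμ a.symm h haA').trans ?_)
        rw [← hPP a (by simp [hPa]) (hPne a.symm haA'), hPa]
      · exfalso
        have hKv : K ⟨v, k⟩ = some l := hx
        have hvB : v ∉ B := fun h => by simp [hB v h k] at hKv
        have hvA : v ∉ A := fun h => h1 v h k hKv
        obtain ⟨u, hu⟩ := (H.degree_pos_iff_exists_adj v).1 ((Nat.zero_le r).trans_lt (hdeg v))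
        let a : H.Dart := ⟨(v, u), hu⟩
        refine h3 v (by simp [hvB, hvA]) ((hμ a hvB hvA).trans ?_)
        rw [← hKP a v rfl hvB (hPU a hvB hvA) k]
        exact hKv
      · exact absurd hx (h4 z)
    rw [mem_oddLabels, ← Nat.not_even_iff_odd] at hl
    apply hl
    rw [← ZMod.natCast_eq_zero_iff_even, card_eq_sum_ones, Nat.cast_sum, Nat.cast_one]
    let g : H.GadgetVertex r s → H.GadgetVertex r s := Sum.map Dart.symm id
    refine sum_involution (fun x _ => g x) (fun x _ => ?_) (fun x hx _ => ?_) (fun x hx => ?_)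
      (fun x _ => ?_)
    · decide
    · obtain ⟨a, rfl, -⟩ := hall x (by simpa using hx)
      simpa [g] using a.symm_ne
    · have hx' : c x = some l := by simpa using hx
      obtain ⟨a, rfl, ha, hb⟩ := hall x hx'
      have := (hPP a (hPB a ha) (hPB a.symm hb)).symm.trans hx'
      simpa [g] using this
    · obtain a | k := x <;> simp [g]
  -- A kept absorbing vertex forces its label `i` on all kept core vertices. Then no dart is
  -- deleted, `A` is empty and `i` is the only possible odd label, whereas a barrier has at least
  -- two.
  by_cases hz : ∃ z, c (.inr (.inr z)) ≠ none
  · obtain ⟨z, hz⟩ := hz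
    obtain ⟨i, hi⟩ := Option.ne_none_iff_exists'.1 hz
    have hKi : ∀ k, K k = none ∨ K k = some i := fun k => by
      by_cases hk : K k = none
      · exact .inl hk
      · rw [← hi]
        exact .inr (hc.eq_of_adj (x := .inr (.inl k)) (y := .inr (.inr z)) trivial hk hz)
    have hPn : ∀ a : H.Dart, P a ≠ none := fun a => hc.dart_ne_none i fun k => hKi _
    have hAe : ∀ v, v ∉ A := by
      intro v hv
      obtain ⟨u, hu⟩ := (H.degree_pos_iff_exists_adj v).1 ((Nat.zero_le r).trans_lt (hdeg v))
      exact hPn ⟨(v, u), hu⟩ (hA ⟨(v, u), hu⟩ hv)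
    have hsub : oddLabels c ⊆ {i} := by
      intro l hl
      rw [mem_singleton]
      apply Option.some_injective
      obtain ⟨v, hv, -⟩ | ⟨a, ⟨-, ha⟩, -⟩ | ⟨v, -, hv⟩ | ⟨y, hy⟩ := hcover l hl
      · exact absurd hv (hAe v)
      · exact absurd ha (hAe _)
      · rw [← hv]
        exact (hKi _).resolve_left (by change μ v ≠ none; simp [hv])
      · obtain rfl : y = z := by
          ext
          omega
        rw [← hy, hi]
    have h1 := card_le_card hsub
    have h2 := hc.card_le
    rw [card_singleton] at h1
    omega
  · push Not at hz
    -- With all absorbing vertices deleted, this upper bound, the lower bound `hlow` and the barrier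
    -- inequality combine to the reverse of `hdef`.
    have hup : #(oddLabels c) ≤ ∑ v ∈ A, (H.degree v - r) +
        ∑ v ∈ B, #(H.neighborFinset v ∩ A) + #((A ∪ B)ᶜ.image μ) := by
      have hsub : (oddLabels c).map .some ⊆ ((A.sigma fun _ => univ).image K ∪
          ({a : H.Dart | a.fst ∈ B ∧ a.snd ∈ A} : Finset _).image P) ∪ (A ∪ B)ᶜ.image μ := by
        intro o ho
        rw [mem_map] at ho
        obtain ⟨l, hl, rfl⟩ := ho
        obtain ⟨v, hv, k, hk⟩ | ⟨a, ha, hPa⟩ | ⟨v, hv, hμv⟩ | ⟨z, hz'⟩ := hcover l hl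
        · exact mem_union_left _ (mem_union_left _ (mem_image.2 ⟨⟨v, k⟩, by simp [hv], hk⟩))
        · exact mem_union_left _ (mem_union_right _ (mem_image.2 ⟨a, by simp [ha], hPa⟩))
        · exact mem_union_right _ (mem_image.2 ⟨v, mem_compl.2 hv, hμv⟩)
        · simp [hz] at hz'
      have h1 := card_le_card hsub
      rw [card_map] at h1
      refine h1.trans ((card_union_le _ _).trans (Nat.add_le_add_right
        ((card_union_le _ _).trans (Nat.add_le_add ?_ ?_)) _))
      · refine card_image_le.trans ?_
        simp
      · refine card_image_le.trans ?_
        rw [card_darts_between]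
    have hlow : ∑ v ∈ A, H.degree v + ∑ v ∈ B, (H.degree v - r) ≤ #(unlabelled c) := by
      have h1 : ∑ v ∈ A, H.degree v = #{a : H.Dart | a.fst ∈ A ∧ a.snd ∈ univ} := by
        rw [card_darts_between]
        simp
      have h2 : ∑ v ∈ B, (H.degree v - r) =
          #((B.sigma fun v => (univ : Finset (Fin (H.degree v - r)))).map
            (Function.Embedding.inl (β := Fin s))) := by
        simp
      rw [h1, h2, ← card_disjSum]
      apply card_le_card
      rintro (a | k | z) hx
      · rw [mem_unlabelled]
        exact hA a (by simpa using hx)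
      · rw [mem_unlabelled]
        exact hB k.1 (by simpa using hx) k.2
      · simp at hx
    have h3 := hdef A B (Option L) μ hAB hμadj
    have h4 := hc.card_le
    have h5 : ∑ v ∈ A, (H.degree v - r) + r * #A = ∑ v ∈ A, H.degree v := by
      rw [mul_comm, ← smul_eq_mul, ← sum_const, ← sum_add_distrib]
      exact sum_congr rfl fun v _ => Nat.sub_add_cancel (hdeg v).le
    have h6 : ∑ v ∈ B, (H.degree v - r) + r * #B =
        ∑ v ∈ B, #(H.neighborFinset v \ A) + ∑ v ∈ B, #(H.neighborFinset v ∩ A) := by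
      rw [mul_comm, ← smul_eq_mul, ← sum_const, ← sum_add_distrib, ← sum_add_distrib]
      refine sum_congr rfl fun v _ => ?_
      rw [Nat.sub_add_cancel (hdeg v).le, card_sdiff_add_card_inter, card_neighborFinset_eq_degree]
    omega

end Barrier

/-- A simple graph with the two toughness bounds has a near `r`-factor. -/
theorem exists_near_factor {V : Type u} [Fintype V] [DecidableEq V] (H : SimpleGraph V)
    {r : ℕ} {s : ℝ}
    (hs0 : 0 < s) (hs1 : s ≤ 1) (hr : 1 ≤ r)
    (hiso : IsolatingBound H (r + s)) (hcomp : ComponentBound H s) :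
    ∃ F : SimpleGraph V, F ≤ H ∧
      (∀ v, (F.neighborSet v).ncard = r ∨ (F.neighborSet v).ncard = r + 1) ∧
      ∀ u v, (F.neighborSet u).ncard = r + 1 → (F.neighborSet v).ncard = r + 1 → u = v := by
  classical
  have hdeg : ∀ v, r < H.degree v := by
    -- Deleting the neighbours of `v` isolates `v`, so `r + s ≤ deg v`; strictness comes from `0 <
    -- s`.
    intro v
    have h := hiso (H.neighborFinset v) {v} (by simp) (by simp)
    rw [card_singleton, Nat.cast_one, mul_one, card_neighborFinset_eq_degree] at h
    exact_mod_cast (show (r : ℝ) < H.degree v by linarith)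
  let s' := (r * Fintype.card V) % 2
  have heven : Even (r * Fintype.card V + s') := by
    rw [Nat.even_iff]
    omega
  have hs' : s' ≤ 1 := by omega
  obtain ⟨M, hM⟩ : ∃ M : (H.gadget r s').Subgraph, M.IsPerfectMatching := by
    by_contra! hcon
    obtain ⟨L, _, c, hc⟩ :=
      exists_isMinBarrier _ (even_card_gadgetVertex (fun v => (hdeg v).le) heven) hcon
    exact not_isMinBarrier_gadget hdeg hs' (fun A B L _ c hAB hadj =>
      H.mul_card_add_card_image_lt hs1 hr hiso hcomp A _ B L c rfl hAB hadj) hc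
  exact exists_factor_of_isPerfectMatching (fun v => (hdeg v).le) hs' hM

end SimpleGraph

namespace Graph

/-! ### Passing between multigraphs and simple graphs -/

section Transfer

variable {α : Type u} {β : Type*} (G : Graph α β)

lemma isolatingBound_toSimpleGraph [G.Loopless] [Fintype G.vertexSet] {t : ℝ} (ht : 0 < t)
    (h : G.IsIsoTough t) : SimpleGraph.IsolatingBound G.toSimpleGraph t := by
  intro S I hSI hnbr
  have h1 := h (Subtype.val '' (S : Set G.vertexSet)) (by simp)
  rw [Set.ncard_image_of_injective _ Subtype.val_injective, Set.ncard_coe_finset] at h1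
  have h2 : I.card ≤ (G.deleteVerts (Subtype.val '' (S : Set G.vertexSet))).numIsolated := by
    rw [← Set.ncard_coe_finset, ← Set.ncard_image_of_injective _ Subtype.val_injective]
    refine Set.ncard_le_ncard ?_ ((Set.toFinite G.vertexSet).subset fun v hv => hv.1.1)
    rintro _ ⟨v, hv, rfl⟩
    have hvS : v ∉ S := fun h => Finset.disjoint_left.1 hSI h hv
    refine ⟨⟨v.2, by simpa using hvS⟩, ?_⟩
    rintro e ⟨y, hy⟩
    rw [deleteVerts_isLink] at hy
    obtain ⟨hy, -, hyS⟩ := hy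
    exact hyS ⟨⟨y, hy.right_mem⟩, hnbr v hv _ ((toSimpleGraph_adj_iff _ _).2 ⟨e, hy⟩), rfl⟩
  have h3 : (I.card : ℝ) ≤ 1 / t * S.card := (Nat.cast_le.2 h2).trans h1
  rwa [one_div_mul_eq_div, le_div_iff₀' ht] at h3

lemma componentBound_toSimpleGraph [Fintype G.vertexSet] [DecidableEq G.vertexSet] {s : ℝ}
    (h : ∀ S ⊆ G.vertexSet, ((G.deleteVerts S).numComponents : ℝ) < s * (S.ncard : ℝ) + 2) :
    SimpleGraph.ComponentBound G.toSimpleGraph s := by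
  classical
  intro S L _ c hc
  have h1 := h (Subtype.val '' (S : Set G.vertexSet)) (by simp)
  rw [Set.ncard_image_of_injective _ Subtype.val_injective, Set.ncard_coe_finset] at h1
  refine lt_of_le_of_lt (Nat.cast_le.2 ?_) h1
  let D := G.deleteVerts (Subtype.val '' (S : Set G.vertexSet))
  have hmem : ∀ x, x ∈ D.vertexSet ↔ ∃ h : x ∈ G.vertexSet, (⟨x, h⟩ : G.vertexSet) ∉ S := by
    intro x
    simp only [D, vertexSet_deleteVerts, Set.mem_sdiff, Set.mem_image, Finset.mem_coe,
      Subtype.exists, exists_and_right, exists_eq_right, not_exists]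
    exact ⟨fun h => ⟨h.1, h.2 h.1⟩, fun ⟨h, h'⟩ => ⟨h, fun _ => h'⟩⟩
  let f : D.vertexSet → L := fun x => c ⟨x, ((hmem x).1 x.2).1⟩
  have hf : ∀ x y, D.toSimpleGraph.Reachable x y → f x = f y := by
    rintro x y ⟨p⟩
    induction p with
    | nil => rfl
    | cons hadj _ ih =>
      refine Eq.trans ?_ ih
      obtain ⟨hne, e, he⟩ := hadj
      refine hc _ _ ((hmem _).1 (Subtype.coe_prop _)).2 ((hmem _).1 (Subtype.coe_prop _)).2
        ⟨fun h => hne (Subtype.ext (Subtype.mk.inj h)), e, (deleteVerts_isLink _ _ |>.1 he).1⟩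
  have : Finite D.vertexSet := (Set.toFinite G.vertexSet).subset fun x hx => ((hmem x).1 hx).1
  let : Fintype D.toSimpleGraph.ConnectedComponent := Fintype.ofFinite _
  -- The labelling is constant on components of the graph without `S`, so each of its values is
  -- attained at a chosen representative of a component.
  have hsub : Sᶜ.image c ⊆
      (Finset.univ : Finset D.toSimpleGraph.ConnectedComponent).image fun C => f C.out := by
    intro l hl
    rw [Finset.mem_image] at hl
    obtain ⟨x, hx, rfl⟩ := hl
    rw [Finset.mem_compl] at hx
    let x' : D.vertexSet := ⟨x, (hmem x).2 ⟨x.2, hx⟩⟩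
    refine Finset.mem_image.2 ⟨D.toSimpleGraph.connectedComponentMk x', Finset.mem_univ _, ?_⟩
    exact hf _ x' (SimpleGraph.ConnectedComponent.exact (Quot.out_eq _))
  refine (Finset.card_le_card hsub).trans (Finset.card_image_le.trans ?_)
  rw [Finset.card_univ, ← Nat.card_eq_fintype_card]
  rfl

/-- A spanning subgraph of the underlying simple graph lifts to a spanning subgraph of `G` with the
same degrees. -/
lemma exists_isSpanningSubgraph_of_le [G.Loopless] {H : SimpleGraph G.vertexSet}
    (hH : H ≤ G.toSimpleGraph) :
    ∃ F : Graph α β, F.IsSpanningSubgraph G ∧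
      ∀ v : G.vertexSet, F.vertexDegree v = (H.neighborSet v).ncard := by
  -- One edge of `G` is chosen from each parallel class used by `H`, which keeps the degrees
  -- unchanged.
  have hex : ∀ p : H.edgeSet, ∃ e, ∀ u v, p.1 = s(u, v) → G.IsLink e u v := by
    rintro ⟨p, hp⟩
    induction p with
    | h x y =>
      obtain ⟨e, he⟩ := (hH hp).2
      refine ⟨e, fun u v huv => ?_⟩
      obtain ⟨rfl, rfl⟩ | ⟨rfl, rfl⟩ := Sym2.eq_iff.1 huv
      exacts [he, he.symm]
  choose ε hε using hex
  refine ⟨G.restrict (Set.range ε), ⟨restrict_le, rfl⟩, fun v => ?_⟩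
  have hloop : (G.restrict (Set.range ε)).loopSet v = ∅ := by
    ext e
    simp [mem_loopSet]
  rw [vertexDegree, hloop, Set.ncard_empty, add_zero]
  symm
  refine Set.ncard_congr (fun u hu => ε ⟨s(v, u), hu⟩) ?_ ?_ ?_
  · intro u hu
    rw [mem_incidenceSet, restrict_inc]
    exact ⟨(hε _ _ _ rfl).inc_left, _, rfl⟩
  · intro u w hu hw huw
    have h1 := hε ⟨s(v, u), hu⟩ _ _ rfl
    rw [huw] at h1
    exact Subtype.ext (h1.right_unique (hε ⟨s(v, w), hw⟩ _ _ rfl))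
  · rintro e he
    rw [mem_incidenceSet, restrict_inc] at he
    obtain ⟨he, ⟨p, hp⟩, rfl⟩ := he
    induction p with
    | h x y =>
      obtain h | h := he.eq_or_eq_of_isLink (hε ⟨s(x, y), hp⟩ _ _ rfl)
      · obtain rfl := Subtype.ext h
        exact ⟨y, hp, rfl⟩
      · obtain rfl := Subtype.ext h
        refine ⟨x, H.adj_symm hp, ?_⟩
        congr 2
        exact Sym2.eq_swap

theorem exists_isNearFactor [G.Loopless] (hV : G.vertexSet.Finite) {r : ℕ} (hr : 1 ≤ r) {n : ℝ}
    (hn : 1 ≤ n) (hiso : G.IsIsoTough (r + 1 / n))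
    (hcomp : ∀ S ⊆ G.vertexSet,
      ((G.deleteVerts S).numComponents : ℝ) < 1 / n * (S.ncard : ℝ) + 2) :
    ∃ F : Graph α β, F.IsNearFactor G fun _ => r := by
  classical
  have := hV.fintype
  have hn0 : 0 < 1 / n := by positivity
  obtain ⟨H, hH, hdeg, huniq⟩ := G.toSimpleGraph.exists_near_factor hn0
    ((div_le_one (by positivity)).2 hn) hr (G.isolatingBound_toSimpleGraph (by positivity) hiso)
    (G.componentBound_toSimpleGraph hcomp)
  obtain ⟨F, hF, hFdeg⟩ := G.exists_isSpanningSubgraph_of_le hH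
  refine ⟨F, hF, fun v hv => ?_, ?_⟩
  · rw [hFdeg ⟨v, hv⟩]
    exact hdeg _
  · rintro u ⟨hu, hur⟩ v ⟨hv, hvr⟩
    rw [hFdeg ⟨u, hu⟩] at hur
    rw [hFdeg ⟨v, hv⟩] at hvr
    exact congrArg Subtype.val (huniq _ _ hur hvr)

end Transfer

end Graph

theorem mainTheorem1 {α β : Type*} (G : Graph α β) (hloop : G.Loopless)
    (hV : G.vertexSet.Finite) (hE : G.edgeSet.Finite) (r : ℕ) (hr : 1 ≤ r) :
    (∀ n : ℝ, 1 ≤ n → G.IsIsoTough (r + 1 / n) →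
      (∀ S ⊆ G.vertexSet,
        ((G.deleteVerts S).numComponents : ℝ) < 1 / n * (S.ncard : ℝ) + 2) →
      ∃ F : Graph α β, F.IsNearFactor G (fun _ => r)) ∧
    (G.IsTough 1 → G.IsIsoTough (r + 1) →
      ∃ F : Graph α β, F.IsNearFactor G (fun _ => r)) := by
  refine ⟨fun n hn hiso hcomp => G.exists_isNearFactor hV hr hn hiso hcomp, fun ht hiso => ?_⟩
  -- The special case is `n = 1`: both `1` and `|S|` are below `|S| + 2`.
  refine G.exists_isNearFactor hV hr le_rfl (by simpa using hiso) fun S hS => ?_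
  refine (ht S hS).trans_lt (max_lt ?_ ?_)
  · have : (0 : ℝ) ≤ S.ncard := by positivity
    linarith
  · linarith
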